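/- Let $\mathbb{D}$ be the open unit disc in $\mathbb{C}$, let $\Omega\subset\mathbb{C}^n$ be a domain (a non-empty connected open set), and let $f:\Omega\to\mathbb{C}$ be holomorphic. For a real-valued $C^2$ function $u$ on $\Omega$, $z\in\Omega$ and $v\in\mathbb{C}^n$, let $$L_z(u,v)=\sum_{k,l=1}^n\frac{\partial^2u}{\partial z_k\,\partial\bar z_l}(z)\,v_k\bar v_l$$ be the Levi form of $u$, and let $$F_K(z,v)=\inf\{\alpha>0 : \text{there is a holomorphic } \varphi:\mathbb{D}\to\Omega \text{ with } \varphi(0)=z,\ \varphi'(0)=v/\alpha\}$$ be the Kobayashi metric of $\Omega$. The function $f$ is called normal on $\Omega$ if there is a constant $C$ such that $$L_z\bigl(\log(1+|f|^2),v\bigr)\le C\cdot F_K(z,v)^2\qquad\text{for all } z\in\Omega,\ v\in\mathbb{C}^n.$$ A family $\mathcal{F}$ of holomorphic functions on $\mathbb{D}$ is called normal on $\mathbb{D}$ if every sequence in $\mathcal{F}$ has either a subsequence that converges uniformly on every compact subset of $\mathbb{D}$ to a finite-valued function, or a subsequence that converges to $\infty$ uniformly on every compact subset of $\mathbb{D}$.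 Theorem. The function $f$ is normal on $\Omega$ if and only if the family $$\mathcal{F}=\{f\circ\varphi : \varphi:\mathbb{D}\to\Omega \text{ holomorphic}\}$$ is normal on $\mathbb{D}$. -/

import Mathlib

open Set Filter Topology Metric

namespace NormalFunctions

/-- A family `𝓕` of complex-valued functions is normal on `U` in the sense of Montel: every sequence
in `𝓕` has a subsequence which converges uniformly on every compact subset of `U` to a
finite-valued function, or a subsequence which converges uniformly to `∞` on every compact
subset of `U`.  Only the values of the functions on `U` matter. -/
def IsNormalFamilyOn {X : Type*} [TopologicalSpace X] (𝓕 : Set (X → ℂ)) (U : Set X) : Prop :=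
  ∀ u : ℕ → X → ℂ, (∀ j, u j ∈ 𝓕) →
    (∃ (s : ℕ → ℕ) (g : X → ℂ), StrictMono s ∧
      ∀ K ⊆ U, IsCompact K → TendstoUniformlyOn (fun j => u (s j)) g atTop K) ∨
    (∃ s : ℕ → ℕ, StrictMono s ∧
      ∀ K ⊆ U, IsCompact K → ∀ R : ℝ, ∀ᶠ j in atTop, ∀ x ∈ K, R < ‖u (s j) x‖)

/-- The holomorphic mappings from the unit disc `𝔻` to `Ω ⊆ ℂⁿ` (as functions on `ℂ` whose
values off the unit disc are irrelevant). -/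
def holDiscs {n : ℕ} (Ω : Set (EuclideanSpace ℂ (Fin n))) : Set (ℂ → EuclideanSpace ℂ (Fin n)) :=
  {φ | DifferentiableOn ℂ φ (ball (0 : ℂ) 1) ∧ MapsTo φ (ball (0 : ℂ) 1) Ω}

/-- The Wirtinger derivative `∂φ/∂z_k = (∂φ/∂x_k - i ∂φ/∂y_k) / 2`. -/
noncomputable def dz {n : ℕ} (k : Fin n) (φ : EuclideanSpace ℂ (Fin n) → ℂ)
    (z : EuclideanSpace ℂ (Fin n)) : ℂ :=
  (fderiv ℝ φ z (EuclideanSpace.single k 1)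
    - Complex.I * fderiv ℝ φ z (EuclideanSpace.single k Complex.I)) / 2

/-- The Wirtinger derivative `∂φ/∂z̄_k = (∂φ/∂x_k + i ∂φ/∂y_k) / 2`. -/
noncomputable def dzbar {n : ℕ} (k : Fin n) (φ : EuclideanSpace ℂ (Fin n) → ℂ)
    (z : EuclideanSpace ℂ (Fin n)) : ℂ :=
  (fderiv ℝ φ z (EuclideanSpace.single k 1)
    + Complex.I * fderiv ℝ φ z (EuclideanSpace.single k Complex.I)) / 2

/-- The Levi form `L_z(φ, v) = ∑_{k,l} ∂²φ/∂z_k∂z̄_l (z) v_k v̄_l` of a real-valued function.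
For `φ` of class `C²` near `z` the form is Hermitian, so the sum is a real number; taking the
real part only serves to record it as an element of `ℝ`. -/
noncomputable def leviForm {n : ℕ} (φ : EuclideanSpace ℂ (Fin n) → ℝ)
    (z v : EuclideanSpace ℂ (Fin n)) : ℝ :=
  (∑ k : Fin n, ∑ l : Fin n,
    dz k (dzbar l (fun w => (φ w : ℂ))) z * v k * (starRingEnd ℂ) (v l)).re

/-- The Kobayashi metric `F_K(z, v)` of `Ω`: the infimum of all `α > 0` for which there is a
holomorphic `φ : 𝔻 → Ω` with `φ(0) = z` and `φ'(0) = v / α`. -/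
noncomputable def kobayashiMetric {n : ℕ} (Ω : Set (EuclideanSpace ℂ (Fin n)))
    (z v : EuclideanSpace ℂ (Fin n)) : ℝ :=
  sInf {α : ℝ | 0 < α ∧ ∃ φ ∈ holDiscs Ω, φ 0 = z ∧ deriv φ 0 = (α : ℂ)⁻¹ • v}

/-- `f` is a normal function on `Ω`: for some constant `C`,
`L_z(log(1 + |f|²), v) ≤ C · F_K(z, v)²` for all `z ∈ Ω` and all `v ∈ ℂⁿ`. -/
def IsNormalFunction {n : ℕ} (Ω : Set (EuclideanSpace ℂ (Fin n)))
    (f : EuclideanSpace ℂ (Fin n) → ℂ) : Prop :=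
  ∃ C : ℝ, ∀ z ∈ Ω, ∀ v : EuclideanSpace ℂ (Fin n),
    leviForm (fun w => Real.log (1 + ‖f w‖ ^ 2)) z v ≤ C * kobayashiMetric Ω z v ^ 2

end NormalFunctions

/-! The Levi form of `log (1 + |f|²)` in direction `v` is the square of `|df_z(v)| / (1 + |f(z)|²)`.
Since the Kobayashi metric is an infimum over discs, normality of `f` means that the spherical
derivative of `f ∘ φ` at `0` is bounded uniformly in the disc `φ`
(`isNormalFunction_iff_sphericalDeriv_le`). Recentring discs turns this into the bound `M / (1 -
|ζ|)` at every `ζ`, and the rest is Marty's theorem.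

Necessity in Marty: spherical derivatives converge when the limit is finite, and stay bounded when
it is `∞`, by inversion and Cauchy's estimate. Sufficiency: the bound makes the maps locally
equi-Lipschitz into the sphere, so Arzelà–Ascoli yields a sphere-valued limit. Its `∞`-set is closed
by continuity and open by Hurwitz applied to reciprocals, hence empty or the whole disc. -/

/-- Directional derivatives of a holomorphic function on an open subset of a finite-dimensional
complex space are holomorphic. -/
theorem NormalFunctions.differentiableAt_fderiv_apply {E : Type*} [NormedAddCommGroup E]
    [NormedSpace ℂ E] [FiniteDimensional ℂ E] {Ω : Set E} (hΩ : IsOpen Ω) {f : E → ℂ}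
    (hf : DifferentiableOn ℂ f Ω) {z : E} (hz : z ∈ Ω) (v : E) :
    DifferentiableAt ℂ (fun w => fderiv ℂ f w v) z := by
  borelize E
  have : ProperSpace E := FiniteDimensional.proper ℂ E
  have hnear : ∀ᶠ w in 𝓝 z, w ∈ Ω ∧ dist (f w) (f z) < 1 :=
    Filter.Eventually.and (hΩ.mem_nhds hz) <|
      (hf.differentiableAt (hΩ.mem_nhds hz)).continuousAt.eventually (ball_mem_nhds _ one_pos)
  obtain ⟨ε, hε, hball⟩ := Metric.eventually_nhds_iff_ball.1 hnear
  have hdiff : ∀ w ∈ ball z ε, DifferentiableAt ℂ f w := fun w hw =>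
    hf.differentiableAt (hΩ.mem_nhds (hball w hw).1)
  -- Circles of this radius in direction `v`, centred in the `ε / 4`-ball, stay in the `ε / 2`-ball;
  -- the `+ 1` covers `v = 0`.
  set r : ℝ := ε / (4 * (‖v‖ + 1)) with hr_def
  have hv : 0 < ‖v‖ + 1 := by positivity
  have hr : 0 < r := by positivity
  have hrv : r * ‖v‖ ≤ ε / 4 := by
    rw [hr_def, div_mul_eq_mul_div, div_le_div_iff₀ (by positivity) (by positivity)]
    nlinarith [norm_nonneg v]
  have hmem : ∀ x ∈ ball z (ε / 4), ∀ ζ : ℂ, ‖ζ‖ ≤ r → x + ζ • v ∈ ball z (ε / 2) := by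
    intro x hx ζ hζ
    rw [mem_ball, dist_eq_norm] at hx ⊢
    calc ‖x + ζ • v - z‖ = ‖(x - z) + ζ • v‖ := by congr 1; abel
      _ ≤ ‖x - z‖ + ‖ζ‖ * ‖v‖ := (norm_add_le _ _).trans (by rw [norm_smul])
      _ ≤ ‖x - z‖ + r * ‖v‖ := by gcongr
      _ < ε / 2 := by linarith
  have hsub : ball z (ε / 2) ⊆ ball z ε := ball_subset_ball (by linarith)
  have hz4 : z ∈ ball z (ε / 4) := mem_ball_self (by positivity)
  set c : ℝ → ℂ := fun θ => deriv (circleMap 0 r) θ * ((circleMap 0 r θ - 0) ^ 2)⁻¹ with hc_def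
  have hc : Continuous c := by
    refine Continuous.mul ?_ (Continuous.inv₀ (by fun_prop) fun θ => ?_)
    · simp only [funext (deriv_circleMap 0 r)]; fun_prop
    · simp [hr.ne']
  have hnorm : ∀ θ : ℝ, ‖circleMap 0 r θ‖ ≤ r := fun θ => by simp [abs_of_pos hr]
  -- Cauchy's formula on a complex line trades the derivative for values of `f`, so one can
  -- differentiate in `x` under the integral.
  have hcauchy : ∀ x ∈ ball z (ε / 4), fderiv ℂ f x v = (2 * ↑Real.pi * Complex.I)⁻¹ •
      ∫ θ in Ioc 0 (2 * Real.pi), c θ * f (x + circleMap 0 r θ • v) := by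
    intro x hx
    have hopen : IsOpen ((fun ζ : ℂ => x + ζ • v) ⁻¹' ball z (ε / 2)) :=
      isOpen_ball.preimage (by fun_prop)
    have hd : DifferentiableOn ℂ (fun ζ : ℂ => f (x + ζ • v))
        ((fun ζ : ℂ => x + ζ • v) ⁻¹' ball z (ε / 2)) := fun ζ hζ =>
      ((hdiff _ (hsub hζ)).comp (f := fun ζ : ℂ => x + ζ • v) ζ
        (by fun_prop)).differentiableWithinAt
    have hx0 : DifferentiableAt ℂ f (x + (0 : ℂ) • v) := by
      simpa using hdiff x (ball_subset_ball (by linarith) hx)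
    have hderiv : HasDerivAt (fun ζ : ℂ => f (x + ζ • v)) (fderiv ℂ f x v) 0 := by
      have h1 : HasDerivAt (fun ζ : ℂ => x + ζ • v) v 0 := by
        simpa using ((hasDerivAt_id (0 : ℂ)).smul_const v).const_add x
      simpa [Function.comp_def] using hx0.hasFDerivAt.comp_hasDerivAt (0 : ℂ) h1
    rw [← hderiv.deriv, ← Complex.two_pi_I_inv_smul_circleIntegral_sub_sq_inv_smul_of_differentiable
      hopen (c := 0) (R := r) (fun ζ hζ => hmem x hx ζ (by simpa using hζ)) hd (mem_ball_self hr)]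
    rw [circleIntegral, intervalIntegral.integral_of_le (by positivity)]
    simp [hc_def, mul_assoc]
  have hint : DifferentiableAt ℂ (fun x => ∫ θ in Ioc 0 (2 * Real.pi),
      c θ * f (x + circleMap 0 r θ • v)) z := by
    have hcont : ∀ x ∈ ball z (ε / 4),
        Continuous fun θ : ℝ => c θ * f (x + circleMap 0 r θ • v) := fun x hx =>
      hc.mul <| continuous_iff_continuousAt.2 fun θ =>
        ContinuousAt.comp (f := fun θ : ℝ => x + circleMap 0 r θ • v)
          (hdiff _ (hsub (hmem x hx _ (hnorm θ)))).continuousAt (by fun_prop)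
    refine (hasFDerivAt_integral_of_dominated_loc_of_lip' (𝕜 := ℂ)
      (F' := fun θ => c θ • fderiv ℂ f (z + circleMap 0 r θ • v))
      (bound := fun θ => ‖c θ‖ * (2 / (ε / 2)))
      (ball_mem_nhds z (by positivity : 0 < ε / 4))
      (fun x hx => (hcont x hx).aestronglyMeasurable)
      ((hcont z hz4).integrableOn_Ioc) ?_ (.of_forall fun θ x hx => ?_)
      ((hc.norm.mul continuous_const).integrableOn_Ioc)
      (.of_forall fun θ => ?_)).2.differentiableAt
    · refine hc.aestronglyMeasurable.smul (Measurable.aestronglyMeasurable ?_)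
      exact (measurable_fderiv ℂ f).comp
        (by fun_prop : Continuous fun θ : ℝ => z + circleMap 0 r θ • v).measurable
    · have hzθ := hmem z hz4 _ (hnorm θ)
      have hss : ball (z + circleMap 0 r θ • v) (ε / 2) ⊆ ball z ε :=
        ball_subset_ball' (by rw [mem_ball] at hzθ; linarith)
      -- Schwarz lemma: values of `f` lie within `1` of `f z`, hence within `2` of each other. This
      -- gives the Lipschitz bound without any prior bound on `fderiv`.
      have := Complex.dist_le_div_mul_dist_of_mapsTo_ball (R₂ := 2)
        (fun w hw => (hdiff w (hss hw)).differentiableWithinAt)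
        (fun w hw => ?_ : MapsTo f (ball (z + circleMap 0 r θ • v) (ε / 2)) _)
        (z := x + circleMap 0 r θ • v) ?_
      · rw [← mul_sub, norm_mul, mul_assoc]
        gcongr
        simpa [dist_eq_norm] using this
      · have h1 := (hball w (hss hw)).2
        have h2 := (hball _ (hsub hzθ)).2
        rw [mem_closedBall]
        linarith [dist_triangle_right (f w) (f (z + circleMap 0 r θ • v)) (f z)]
      · rw [mem_ball] at hx ⊢
        rw [dist_add_right]; linarith
    · have := ((hdiff _ (hsub (hmem z hz4 _ (hnorm θ)))).hasFDerivAt.comp z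
        (f := fun x => x + circleMap 0 r θ • v) ((hasFDerivAt_id z).add_const _)).const_mul (c θ)
      simpa [Function.comp_def] using this
  refine (hint.const_smul ((2 * ↑Real.pi * Complex.I)⁻¹ : ℂ)).congr_of_eventuallyEq ?_
  filter_upwards [ball_mem_nhds z (by positivity : 0 < ε / 4)] with x hx using hcauchy x hx

namespace NormalFunctions

variable {n : ℕ} {Ω : Set (EuclideanSpace ℂ (Fin n))} {f : EuclideanSpace ℂ (Fin n) → ℂ}

/-! ### The Levi form of `log (1 + |f|²)`. -/

/-- In `f * conj f` only the conjugate factor is hit by `∂/∂z̄`. The denominator is left as `1 + f *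
conj f`, ready for the product rule at the second differentiation. -/
theorem dzbar_log_one_add_norm_sq {w : EuclideanSpace ℂ (Fin n)} (hf : DifferentiableAt ℂ f w)
    (l : Fin n) :
    dzbar l (fun w => (Real.log (1 + ‖f w‖ ^ 2) : ℂ)) w =
      f w * (starRingEnd ℂ) (fderiv ℂ f w (EuclideanSpace.single l 1)) *
        (1 + f w * (starRingEnd ℂ) (f w))⁻¹ := by
  have hpos : (1 : ℝ) + ‖f w‖ ^ 2 ≠ 0 := by positivity
  have h := (((hf.hasFDerivAt.restrictScalars ℝ).norm_sq.const_add 1).log hpos)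
  have h2 := (Complex.ofRealCLM.hasFDerivAt.comp w h)
  have h3 : (EuclideanSpace.single l Complex.I : EuclideanSpace ℂ (Fin n))
      = Complex.I • EuclideanSpace.single l 1 := by ext i; simp
  have hD : (1 : ℂ) + f w * (starRingEnd ℂ) (f w) = ((1 + ‖f w‖ ^ 2 : ℝ) : ℂ) := by
    rw [Complex.mul_conj, Complex.normSq_eq_norm_sq]; push_cast; rfl
  have hfd : fderiv ℝ (fun w => (Real.log (1 + ‖f w‖ ^ 2) : ℂ)) w = _ := h2.fderiv
  rw [dzbar, hfd, hD, h3]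
  have hpos' : ((1 + ‖f w‖ ^ 2 : ℝ) : ℂ) ≠ 0 := by exact_mod_cast hpos
  set a := fderiv ℂ f w (EuclideanSpace.single l 1)
  simp only [ContinuousLinearMap.comp_apply, smul_apply,
    ContinuousLinearMap.coe_restrictScalars', map_smul, Complex.ofRealCLM_apply, innerSL_apply_apply,
    Complex.inner, smul_eq_mul]
  apply Complex.ext <;> simp [-Complex.ofReal_add] <;> field_simp <;> ring

/-- `∂/∂z_k` kills `conj (∂_l f)`; the two remaining terms combine through `1 / D - |f|² / D² = 1 /
D²` with `D = 1 + |f|²`. -/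
theorem dz_dzbar_log_one_add_norm_sq (hΩ : IsOpen Ω) (hf : DifferentiableOn ℂ f Ω)
    {z : EuclideanSpace ℂ (Fin n)} (hz : z ∈ Ω) (k l : Fin n) :
    dz k (dzbar l (fun w => (Real.log (1 + ‖f w‖ ^ 2) : ℂ))) z =
      fderiv ℂ f z (EuclideanSpace.single k 1) *
        (starRingEnd ℂ) (fderiv ℂ f z (EuclideanSpace.single l 1)) *
          (((1 + ‖f z‖ ^ 2 : ℝ) : ℂ) ^ 2)⁻¹ := by
  have heq : dzbar l (fun w => (Real.log (1 + ‖f w‖ ^ 2) : ℂ)) =ᶠ[𝓝 z] fun w =>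
      f w * (starRingEnd ℂ) (fderiv ℂ f w (EuclideanSpace.single l 1)) *
        (1 + f w * (starRingEnd ℂ) (f w))⁻¹ := by
    filter_upwards [hΩ.mem_nhds hz] with w hw using
      dzbar_log_one_add_norm_sq (hf.differentiableAt (hΩ.mem_nhds hw)) l
  have hD : (1 : ℂ) + f z * (starRingEnd ℂ) (f z) = ((1 + ‖f z‖ ^ 2 : ℝ) : ℂ) := by
    rw [Complex.mul_conj, Complex.normSq_eq_norm_sq]; push_cast; rfl
  have hpos : (1 : ℂ) + f z * (starRingEnd ℂ) (f z) ≠ 0 := by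
    rw [hD]; exact_mod_cast (by positivity : (1 : ℝ) + ‖f z‖ ^ 2 ≠ 0)
  have h1 := (hf.differentiableAt (hΩ.mem_nhds hz)).hasFDerivAt.restrictScalars ℝ
  have h2 := (differentiableAt_fderiv_apply hΩ hf hz
    (EuclideanSpace.single l 1)).hasFDerivAt.restrictScalars ℝ
  have hconj : ∀ {g : EuclideanSpace ℂ (Fin n) → ℂ} {g' : EuclideanSpace ℂ (Fin n) →L[ℝ] ℂ},
      HasFDerivAt g g' z → HasFDerivAt (fun w => (starRingEnd ℂ) (g w))
        ((Complex.conjCLE : ℂ →L[ℝ] ℂ).comp g') z := fun h =>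
    (Complex.conjCLE : ℂ →L[ℝ] ℂ).hasFDerivAt.comp z h
  have hG := (h1.mul (hconj h2)).mul
    ((hasDerivAt_inv hpos).comp_hasFDerivAt_of_eq z ((h1.mul (hconj h1)).const_add 1) rfl)
  have h3 : (EuclideanSpace.single k Complex.I : EuclideanSpace ℂ (Fin n))
      = Complex.I • EuclideanSpace.single k 1 := by ext i; simp
  have hfd : fderiv ℝ (fun w => f w *
      (starRingEnd ℂ) (fderiv ℂ f w (EuclideanSpace.single l 1)) *
        (1 + f w * (starRingEnd ℂ) (f w))⁻¹) z = _ := hG.fderiv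
  rw [dz, heq.fderiv_eq, hfd, h3, ← hD]
  simp
  field_simp
  rw [Complex.I_sq]
  ring

/-- The Levi matrix has the rank-one shape `∂_k f * conj (∂_l f)`, so the form is a squared modulus.
-/
theorem leviForm_log_one_add_norm_sq (hΩ : IsOpen Ω) (hf : DifferentiableOn ℂ f Ω)
    {z : EuclideanSpace ℂ (Fin n)} (hz : z ∈ Ω) (v : EuclideanSpace ℂ (Fin n)) :
    leviForm (fun w => Real.log (1 + ‖f w‖ ^ 2)) z v =
      (‖fderiv ℂ f z v‖ / (1 + ‖f z‖ ^ 2)) ^ 2 := by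
  have hv : fderiv ℂ f z v = ∑ k, fderiv ℂ f z (EuclideanSpace.single k 1) * v k := by
    conv_lhs => rw [show v = ∑ k, v k • EuclideanSpace.single k (1 : ℂ) by
      ext i; simp [Finset.sum_apply, Pi.single_apply]]
    simp [mul_comm]
  have hsum : (∑ k : Fin n, ∑ l : Fin n,
      dz k (dzbar l (fun w => (Real.log (1 + ‖f w‖ ^ 2) : ℂ))) z * v k * (starRingEnd ℂ) (v l)) =
      (((‖fderiv ℂ f z v‖ / (1 + ‖f z‖ ^ 2)) ^ 2 : ℝ) : ℂ) := by
    rw [div_pow, Complex.ofReal_div, Complex.ofReal_pow, Complex.ofReal_pow, ← Complex.mul_conj',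
      hv, map_sum, Finset.sum_mul_sum, div_eq_mul_inv, Finset.sum_mul]
    refine Finset.sum_congr rfl fun k _ => ?_
    rw [Finset.sum_mul]
    refine Finset.sum_congr rfl fun l _ => ?_
    rw [dz_dzbar_log_one_add_norm_sq hΩ hf hz, map_mul]
    ring
  rw [leviForm, hsum, Complex.ofReal_re]

/-! ### Spherical derivatives along holomorphic discs. -/

/-- The spherical derivative `|g'| / (1 + |g|²)`. -/
noncomputable def sphericalDeriv (g : ℂ → ℂ) (ζ : ℂ) : ℝ :=
  ‖deriv g ζ‖ / (1 + ‖g ζ‖ ^ 2)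

theorem sphericalDeriv_nonneg (g : ℂ → ℂ) (ζ : ℂ) : 0 ≤ sphericalDeriv g ζ := by
  unfold sphericalDeriv; positivity

theorem differentiableOn_comp_of_mem_holDiscs (hf : DifferentiableOn ℂ f Ω)
    {φ : ℂ → EuclideanSpace ℂ (Fin n)} (hφ : φ ∈ holDiscs Ω) :
    DifferentiableOn ℂ (f ∘ φ) (ball 0 1) :=
  hf.comp hφ.1 hφ.2

theorem deriv_comp_of_mem_holDiscs (hΩ : IsOpen Ω) (hf : DifferentiableOn ℂ f Ω)
    {φ : ℂ → EuclideanSpace ℂ (Fin n)} (hφ : φ ∈ holDiscs Ω) :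
    deriv (f ∘ φ) 0 = fderiv ℂ f (φ 0) (deriv φ 0) := by
  have h0 : (0 : ℂ) ∈ ball (0 : ℂ) 1 := mem_ball_self one_pos
  exact ((hf.differentiableAt (hΩ.mem_nhds (hφ.2 h0))).hasFDerivAt.comp_hasDerivAt (0 : ℂ)
    (hφ.1.differentiableAt (isOpen_ball.mem_nhds h0)).hasDerivAt).deriv

/-- Through every point of an open set, in every direction, there is a holomorphic disc. -/
theorem exists_holDisc (hΩ : IsOpen Ω) {z : EuclideanSpace ℂ (Fin n)} (hz : z ∈ Ω)
    (v : EuclideanSpace ℂ (Fin n)) :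
    ∃ α : ℝ, 0 < α ∧ ∃ φ ∈ holDiscs Ω, φ 0 = z ∧ deriv φ 0 = (α : ℂ)⁻¹ • v := by
  obtain ⟨ε, hε, hball⟩ := Metric.isOpen_iff.1 hΩ z hz
  have hv : 0 < ‖v‖ + 1 := by positivity
  refine ⟨(‖v‖ + 1) / ε, by positivity, fun ζ => z + ζ • ((((‖v‖ + 1) / ε : ℝ) : ℂ)⁻¹ • v),
    ⟨by fun_prop, fun ζ hζ => hball ?_⟩, by simp, ?_⟩
  · rw [mem_ball_zero_iff] at hζ
    rw [mem_ball, dist_eq_norm, add_sub_cancel_left, norm_smul, norm_smul, norm_inv,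
      Complex.norm_real, Real.norm_of_nonneg (by positivity), inv_div]
    calc ‖ζ‖ * (ε / (‖v‖ + 1) * ‖v‖) ≤ 1 * (ε / (‖v‖ + 1) * ‖v‖) := by gcongr
      _ < ε := by
        rw [one_mul, div_mul_eq_mul_div, div_lt_iff₀ hv]
        nlinarith
  · simpa using (((hasDerivAt_id (0 : ℂ)).smul_const _).const_add z).deriv

/-- A function is normal if and only if its restrictions to holomorphic discs have bounded spherical
derivative at the centre. -/
theorem isNormalFunction_iff_sphericalDeriv_le (hΩ : IsOpen Ω) (hf : DifferentiableOn ℂ f Ω) :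
    IsNormalFunction Ω f ↔ ∃ M : ℝ, ∀ φ ∈ holDiscs Ω, sphericalDeriv (f ∘ φ) 0 ≤ M := by
  constructor
  · rintro ⟨C, hC⟩
    refine ⟨√|C|, fun φ hφ => Real.le_sqrt_of_sq_le ?_⟩
    have hz : φ 0 ∈ Ω := hφ.2 (mem_ball_self one_pos)
    have hK0 : 0 ≤ kobayashiMetric Ω (φ 0) (deriv φ 0) :=
      Real.sInf_nonneg fun α hα => hα.1.le
    -- The disc `φ` itself is a competitor with `α = 1`.
    have hK1 : kobayashiMetric Ω (φ 0) (deriv φ 0) ≤ 1 :=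
      csInf_le ⟨0, fun α hα => hα.1.le⟩ ⟨one_pos, φ, hφ, rfl, by simp⟩
    have h := hC (φ 0) hz (deriv φ 0)
    rw [leviForm_log_one_add_norm_sq hΩ hf hz, ← deriv_comp_of_mem_holDiscs hΩ hf hφ] at h
    calc sphericalDeriv (f ∘ φ) 0 ^ 2
        ≤ C * kobayashiMetric Ω (φ 0) (deriv φ 0) ^ 2 := h
      _ ≤ |C| * 1 ^ 2 := by gcongr; exact le_abs_self C
      _ = |C| := by ring
  · rintro ⟨M, hM⟩
    refine ⟨M ^ 2, fun z hz v => ?_⟩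
    rw [leviForm_log_one_add_norm_sq hΩ hf hz, ← mul_pow]
    -- Some disc must exist for `M` to be seen to be nonnegative.
    obtain ⟨-, -, φ₀, hφ₀, -, -⟩ := exists_holDisc hΩ hz v
    have hM0 : 0 ≤ M := (sphericalDeriv_nonneg _ _).trans (hM φ₀ hφ₀)
    gcongr
    unfold kobayashiMetric
    rw [← smul_eq_mul, ← Real.sInf_smul_of_nonneg hM0]
    refine le_csInf (Set.Nonempty.smul_set (exists_holDisc hΩ hz v)) ?_
    rintro _ ⟨α, ⟨hα, φ, hφ, rfl, hd⟩, rfl⟩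
    have h := hM φ hφ
    rw [sphericalDeriv, deriv_comp_of_mem_holDiscs hΩ hf hφ, hd, map_smul, norm_smul, norm_inv,
      Complex.norm_real, Real.norm_of_nonneg hα.le, mul_div_assoc, inv_mul_le_iff₀ hα] at h
    simpa [mul_comm] using h

/-- The affine map `w ↦ ζ + (1 - |ζ|) w` sends the disc into itself and `0` to `ζ`, so precomposing
`φ` with it gives another admissible disc. -/
theorem sphericalDeriv_comp_le (hf : DifferentiableOn ℂ f Ω) {M : ℝ}
    (hM : ∀ φ ∈ holDiscs Ω, sphericalDeriv (f ∘ φ) 0 ≤ M) {φ : ℂ → EuclideanSpace ℂ (Fin n)}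
    (hφ : φ ∈ holDiscs Ω) {ζ : ℂ} (hζ : ζ ∈ ball (0 : ℂ) 1) :
    sphericalDeriv (f ∘ φ) ζ ≤ M / (1 - ‖ζ‖) := by
  rw [mem_ball_zero_iff] at hζ
  set r : ℝ := 1 - ‖ζ‖ with hr_def
  have hr : 0 < r := by linarith
  have hmaps : MapsTo (fun w : ℂ => ζ + r * w) (ball 0 1) (ball 0 1) := by
    intro w hw
    rw [mem_ball_zero_iff] at hw ⊢
    calc ‖ζ + r * w‖ ≤ ‖ζ‖ + r * ‖w‖ := (norm_add_le _ _).trans_eq (by simp [abs_of_pos hr])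
      _ < ‖ζ‖ + r * 1 := by gcongr
      _ = 1 := by rw [hr_def]; ring
  have hψ : (φ ∘ fun w : ℂ => ζ + r * w) ∈ holDiscs Ω :=
    ⟨hφ.1.comp (by fun_prop) hmaps, hφ.2.comp hmaps⟩
  have h := hM _ hψ
  have hg : DifferentiableAt ℂ (f ∘ φ) (ζ + r * 0) := by
    simpa using (differentiableOn_comp_of_mem_holDiscs hf hφ).differentiableAt
      (isOpen_ball.mem_nhds (mem_ball_zero_iff.2 hζ))
  have hd : deriv (f ∘ φ ∘ fun w : ℂ => ζ + r * w) 0 = deriv (f ∘ φ) ζ * r := by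
    have h1 : HasDerivAt (fun w : ℂ => ζ + r * w) r 0 := by
      simpa using ((hasDerivAt_id (0 : ℂ)).const_mul (r : ℂ)).const_add ζ
    simpa [Function.comp_assoc] using (hg.hasDerivAt.comp (0 : ℂ) h1).deriv
  rw [sphericalDeriv, hd, norm_mul, Complex.norm_real, Real.norm_of_nonneg hr.le] at h
  rw [le_div_iff₀ hr, sphericalDeriv, div_mul_eq_mul_div]
  simpa using h

/-- Inversion is an isometry of the sphere; this reduces behaviour near `∞` to behaviour near `0`.
-/
theorem sphericalDeriv_inv {g : ℂ → ℂ} {ζ : ℂ} (hg : DifferentiableAt ℂ g ζ) (h0 : g ζ ≠ 0) :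
    sphericalDeriv g⁻¹ ζ = sphericalDeriv g ζ := by
  have := norm_pos_iff.2 h0
  rw [sphericalDeriv, sphericalDeriv, (hg.hasDerivAt.inv h0).deriv]
  simp only [norm_div, norm_neg, norm_pow, Pi.inv_apply, norm_inv]
  field_simp
  ring

/-! ### Marty's theorem, necessity. -/

/-- A normal family on the unit disc has bounded spherical derivative at the centre. -/
theorem IsNormalFamilyOn.exists_sphericalDeriv_le {𝓕 : Set (ℂ → ℂ)}
    (h𝓕 : IsNormalFamilyOn 𝓕 (ball 0 1)) (hd : ∀ g ∈ 𝓕, DifferentiableOn ℂ g (ball 0 1)) :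
    ∃ M : ℝ, ∀ g ∈ 𝓕, sphericalDeriv g 0 ≤ M := by
  by_contra! hcon
  choose u hu hlarge using fun j : ℕ => hcon j
  have h0 : (0 : ℂ) ∈ ball (0 : ℂ) 1 := mem_ball_self one_pos
  have htop : ∀ s : ℕ → ℕ, StrictMono s →
      Tendsto (fun j => sphericalDeriv (u (s j)) 0) atTop atTop := fun s hs =>
    tendsto_atTop_mono (fun j => (hlarge (s j)).le)
      (tendsto_natCast_atTop_atTop.comp hs.tendsto_atTop)
  rcases h𝓕 u hu with ⟨s, g, hs, hg⟩ | ⟨s, hs, hinf⟩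
  · have hlu : TendstoLocallyUniformlyOn (fun j => u (s j)) g atTop (ball 0 1) :=
      (tendstoLocallyUniformlyOn_iff_forall_isCompact isOpen_ball).2 hg
    have h1 := (hlu.deriv (.of_forall fun j => hd _ (hu (s j))) isOpen_ball).tendsto_at h0
    have h2 := hlu.tendsto_at h0
    have h3 : Tendsto (fun j => sphericalDeriv (u (s j)) 0) atTop (𝓝 (sphericalDeriv g 0)) :=
      h1.norm.div ((h2.norm.pow 2).const_add 1) (by positivity)
    exact not_tendsto_nhds_of_tendsto_atTop (htop s hs) _ h3
  · have hsub : closedBall (0 : ℂ) (1 / 2) ⊆ ball 0 1 := closedBall_subset_ball (by norm_num)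
    have hbd : ∀ᶠ j in atTop, sphericalDeriv (u (s j)) 0 ≤ 2 := by
      -- Once `|u| > 1` on the half disc, `|1/u| ≤ 1` there, and Cauchy's estimate at radius `1/2`
      -- gives the bound `2`.
      filter_upwards [hinf _ hsub (isCompact_closedBall _ _) 1] with j hj
      have hne : ∀ x ∈ closedBall (0 : ℂ) (1 / 2), u (s j) x ≠ 0 := fun x hx h => by
        have := hj x hx
        rw [h, norm_zero] at this
        linarith
      have h00 : (0 : ℂ) ∈ closedBall (0 : ℂ) (1 / 2) := mem_closedBall_self (by norm_num)
      rw [← sphericalDeriv_inv ((hd _ (hu _)).differentiableAt (isOpen_ball.mem_nhds h0))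
        (hne 0 h00)]
      have hdiff : DifferentiableOn ℂ (u (s j))⁻¹ (closedBall (0 : ℂ) (1 / 2)) :=
        ((hd _ (hu _)).mono hsub).inv hne
      have := Complex.norm_deriv_le_of_forall_mem_sphere_norm_le (c := 0) (C := 1)
        (by norm_num : (0 : ℝ) < 1 / 2)
        (hdiff.diffContOnCl_ball subset_rfl) fun z hz => by
          rw [Pi.inv_apply, norm_inv]
          exact inv_le_one_of_one_le₀ (hj z (sphere_subset_closedBall hz)).le
      calc sphericalDeriv (u (s j))⁻¹ 0 ≤ ‖deriv (u (s j))⁻¹ 0‖ :=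
            div_le_self (norm_nonneg _) (by nlinarith [sq_nonneg ‖(u (s j))⁻¹ 0‖])
        _ ≤ 2 := this.trans_eq (by norm_num)
    obtain ⟨j, hj, hj'⟩ := (hbd.and ((htop s hs).eventually_gt_atTop 2)).exists
    linarith

/-! ### Compactness, continuous convergence and Hurwitz. -/

/-- An equicontinuous sequence of functions with values in a compact set has a subsequence
converging in the compact-open topology. -/
theorem exists_subseq_tendsto_of_equicontinuous {X Y : Type*} [TopologicalSpace X]
    [SecondCountableTopology X] [LocallyCompactSpace X] [MetricSpace Y]
    [SecondCountableTopology Y] {K : Set Y} (hK : IsCompact K) (G : ℕ → C(X, Y))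
    (hG : Equicontinuous fun j => ⇑(G j)) (hGK : ∀ j x, G j x ∈ K) :
    ∃ (g : C(X, Y)) (s : ℕ → ℕ), StrictMono s ∧ Tendsto (fun j => G (s j)) atTop (𝓝 g) := by
  -- This pointwise closure is compact by Tychonoff; it remains equicontinuous, so all its members
  -- are continuous.
  set A : Set (X → Y) := closure (range fun j => ⇑(G j)) with hA_def
  have hA : A.Equicontinuous := Set.Equicontinuous.closure (equicontinuous_iff_range.1 hG)
  have hAK : A ⊆ univ.pi fun _ => K :=
    closure_minimal (by rintro _ ⟨j, rfl⟩ x -; exact hGK j x)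
      (isClosed_set_pi fun _ _ => hK.isClosed)
  have hAc : IsCompact A :=
    (isCompact_univ_pi fun _ => hK).of_isClosed_subset isClosed_closure hAK
  have hS : IsCompact {g : C(X, Y) | ⇑g ∈ A} := by
    refine ArzelaAscoli.isCompact_of_equicontinuous _ ?_ ?_
    · convert hAc
      ext g
      exact ⟨by rintro ⟨h, hh, rfl⟩; exact hh,
        fun hg => ⟨⟨g, hA.continuous_of_mem hg⟩, hg, rfl⟩⟩
    · exact hA.comp fun g : {g : C(X, Y) | ⇑g ∈ A} => (⟨⇑g.1, g.2⟩ : A)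
  obtain ⟨g, -, s, hs, hlim⟩ := hS.tendsto_subseq fun j => subset_closure (mem_range_self j)
  exact ⟨g, s, hs, hlim⟩

/-- For a continuous limit, locally uniform convergence is continuous convergence. -/
theorem tendstoLocallyUniformlyOn_iff_continuousConvergence {X Y ι : Type*} [TopologicalSpace X]
    [UniformSpace Y] {F : ι → X → Y} {g : X → Y} {s : Set X} {p : Filter ι}
    (hg : ContinuousOn g s) :
    TendstoLocallyUniformlyOn F g p s ↔
      ∀ x ∈ s, Tendsto (fun y : ι × X => F y.1 y.2) (p ×ˢ 𝓝[s] x) (𝓝 (g x)) := by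
  rw [tendstoLocallyUniformlyOn_iff_forall_tendsto]
  refine forall₂_congr fun x hx => ?_
  have hgx : Tendsto (fun y : ι × X => g y.2) (p ×ˢ 𝓝[s] x) (𝓝 (g x)) :=
    (hg x hx).tendsto.comp tendsto_snd
  refine ⟨fun h => ?_, fun h => ?_⟩
  · exact hgx.congr_uniformity h
  · exact (hgx.prodMk_nhds h).mono_right (nhds_le_uniformity _)

/-- **Hurwitz's theorem**, local form. -/
theorem eventually_eq_zero_of_tendstoLocallyUniformlyOn {U : Set ℂ} (hU : IsOpen U)
    {F : ℕ → ℂ → ℂ} {h : ℂ → ℂ} (hF : ∀ᶠ j in atTop, DifferentiableOn ℂ (F j) U)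
    (hF0 : ∀ᶠ j in atTop, ∀ z ∈ U, F j z ≠ 0) (hlim : TendstoLocallyUniformlyOn F h atTop U)
    {a : ℂ} (ha : a ∈ U) (h0 : h a = 0) : ∀ᶠ z in 𝓝 a, h z = 0 := by
  have hh : DifferentiableOn ℂ h U := hlim.differentiableOn hF hU
  refine ((hh.analyticAt (hU.mem_nhds ha)).eventually_eq_zero_or_eventually_ne_zero).resolve_right
    fun hne => ?_
  rw [eventually_nhdsWithin_iff] at hne
  obtain ⟨ε, hε, hball⟩ := Metric.eventually_nhds_iff_ball.1
    (hne.and (hU.mem_nhds ha : ∀ᶠ z in 𝓝 a, z ∈ U))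
  have hr : 0 < ε / 2 := by positivity
  have hcb : closedBall a (ε / 2) ⊆ ball a ε := closedBall_subset_ball (by linarith)
  have hcU : closedBall a (ε / 2) ⊆ U := fun z hz => (hball z (hcb hz)).2
  -- With `δ` the minimum of `|h|` on the circle, `|F j| ≥ δ / 2` there eventually. The maximum
  -- principle for `1 / F j` carries this to `a`, against `F j a → h a = 0`.
  obtain ⟨z₀, hz₀, hmin⟩ := (isCompact_sphere a (ε / 2)).exists_isMinOn
    (NormedSpace.sphere_nonempty.2 hr.le)
    ((hh.continuousOn.mono (sphere_subset_closedBall.trans hcU)).norm)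
  have hδ : 0 < ‖h z₀‖ := norm_pos_iff.2 <|
    (hball z₀ (hcb (sphere_subset_closedBall hz₀))).1 (ne_of_mem_sphere hz₀ hr.ne')
  have hunif := (tendstoLocallyUniformlyOn_iff_forall_isCompact hU).1 hlim _ hcU
    (isCompact_closedBall a (ε / 2))
  rw [Metric.tendstoUniformlyOn_iff] at hunif
  obtain ⟨j, hj, hj0, hjd⟩ := ((hunif (‖h z₀‖ / 2) (by positivity)).and (hF0.and hF)).exists
  have hinv : DifferentiableOn ℂ (F j)⁻¹ (closedBall a (ε / 2)) :=
    (hjd.mono hcU).inv fun z hz => hj0 z (hcU hz)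
  have hmax := Complex.norm_le_of_forall_mem_frontier_norm_le (C := (‖h z₀‖ / 2)⁻¹)
    isBounded_ball (hinv.diffContOnCl_ball subset_rfl) (fun z hz => ?_)
    (subset_closure (mem_ball_self hr))
  · have hja := hj a (mem_closedBall_self hr.le)
    rw [h0, dist_zero_left] at hja
    rw [Pi.inv_apply, norm_inv,
      inv_le_inv₀ (norm_pos_iff.2 (hj0 a ha)) (by positivity)] at hmax
    linarith
  · rw [frontier_ball _ hr.ne'] at hz
    have h1 : ‖h z₀‖ ≤ ‖h z‖ := hmin hz
    have h2 := hj z (sphere_subset_closedBall hz)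
    rw [dist_eq_norm] at h2
    have h3 := norm_sub_norm_le (h z) (F j z)
    rw [Pi.inv_apply, norm_inv]
    exact inv_anti₀ (by positivity) (by linarith)

/-! ### The Riemann sphere in `ℝ × ℂ`. -/

/-- A chart of the Riemann sphere: `w ↦ (1 / (1 + |w|²), w / (1 + |w|²))`. -/
noncomputable def sphereMap (w : ℂ) : ℝ × ℂ :=
  ((1 + ‖w‖ ^ 2)⁻¹, (1 + ‖w‖ ^ 2)⁻¹ • w)

theorem sphereMap_mem_closedBall (w : ℂ) : sphereMap w ∈ closedBall (0 : ℝ × ℂ) 1 := by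
  have hpos : 0 < 1 + ‖w‖ ^ 2 := by positivity
  rw [mem_closedBall_zero_iff, sphereMap, Prod.norm_mk, norm_smul, norm_inv,
    Real.norm_of_nonneg hpos.le, max_le_iff, inv_mul_le_iff₀ hpos]
  exact ⟨inv_le_one_of_one_le₀ (by nlinarith [norm_nonneg w]),
    by nlinarith [sq_nonneg (‖w‖ - 1)]⟩

/-- This is the equation of the sphere, with `∞` at the origin. It passes to limits, where a
vanishing first coordinate then forces the second to vanish. -/
theorem norm_sphereMap_snd_sq (w : ℂ) :
    ‖(sphereMap w).2‖ ^ 2 = (sphereMap w).1 * (1 - (sphereMap w).1) := by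
  have hpos : 0 < 1 + ‖w‖ ^ 2 := by positivity
  simp only [sphereMap, norm_smul, norm_inv, Real.norm_of_nonneg hpos.le]
  field_simp
  ring

/-- The decay `(1 + |w|²)⁻¹` is the weight in `sphericalDeriv`. The `3` is `1 + 2`, from the two
terms of the product rule in the second coordinate. -/
theorem sphereMap_hasFDerivAt (w : ℂ) : ∃ T : ℂ →L[ℝ] ℝ × ℂ,
    HasFDerivAt sphereMap T w ∧ ‖T‖ ≤ 3 * (1 + ‖w‖ ^ 2)⁻¹ := by
  have hpos : 0 < 1 + ‖w‖ ^ 2 := by positivity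
  have h1 := (hasDerivAt_inv hpos.ne').comp_hasFDerivAt w
    (((hasFDerivAt_id (𝕜 := ℝ) w).norm_sq).const_add 1)
  refine ⟨_, h1.prodMk (h1.smul (hasFDerivAt_id w)), ?_⟩
  refine ContinuousLinearMap.opNorm_le_bound _ (by positivity) fun v => ?_
  set D := 1 + ‖w‖ ^ 2 with hD
  have hin : |inner ℝ w v| ≤ ‖w‖ * ‖v‖ := abs_real_inner_le_norm w v
  have hw1 : 2 * ‖w‖ ≤ D := by nlinarith [sq_nonneg (‖w‖ - 1)]
  have hw2 : ‖w‖ ^ 2 ≤ D := by linarith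
  have hu : |-(D ^ 2)⁻¹ * (2 * inner ℝ w v)| ≤ (D ^ 2)⁻¹ * (2 * (‖w‖ * ‖v‖)) := by
    rw [abs_mul, abs_neg, abs_mul, abs_of_pos (by positivity : (0 : ℝ) < (D ^ 2)⁻¹), abs_two]
    gcongr
  have hDD : (D ^ 2)⁻¹ * D = D⁻¹ := by field_simp
  have hb1 : (D ^ 2)⁻¹ * (2 * (‖w‖ * ‖v‖)) ≤ D⁻¹ * ‖v‖ := by
    rw [← hDD, mul_assoc (D ^ 2)⁻¹, ← mul_assoc 2]
    gcongr
  have hb2 : (D ^ 2)⁻¹ * (2 * (‖w‖ * ‖v‖)) * ‖w‖ ≤ 2 * (D⁻¹ * ‖v‖) := by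
    rw [← hDD]
    calc (D ^ 2)⁻¹ * (2 * (‖w‖ * ‖v‖)) * ‖w‖ = (D ^ 2)⁻¹ * (2 * (‖w‖ ^ 2 * ‖v‖)) := by ring
      _ ≤ (D ^ 2)⁻¹ * (2 * (D * ‖v‖)) := by gcongr
      _ = _ := by ring
  have hDv : 0 ≤ D⁻¹ * ‖v‖ := by positivity
  have hT1 : ‖-(D ^ 2)⁻¹ * (2 * inner ℝ w v)‖ ≤ 3 * D⁻¹ * ‖v‖ := by
    rw [Real.norm_eq_abs]; linarith
  have hT2 : ‖D⁻¹ • v + (-(D ^ 2)⁻¹ * (2 * inner ℝ w v)) • w‖ ≤ 3 * D⁻¹ * ‖v‖ := by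
    refine (norm_add_le _ _).trans ?_
    rw [norm_smul, norm_smul, Real.norm_of_nonneg (by positivity : 0 ≤ D⁻¹), Real.norm_eq_abs]
    have := (mul_le_mul_of_nonneg_right hu (norm_nonneg w)).trans hb2
    linarith
  rw [Prod.norm_def, max_le_iff]
  constructor
  · refine le_of_eq_of_le (congrArg norm ?_) hT1
    simp [hD]
    left; ring
  · refine le_of_eq_of_le (congrArg norm ?_) hT2
    simp [hD]
    left; left; ring

theorem dist_sphereMap_comp_le {g : ℂ → ℂ} {s : Set ℂ} (hs : IsOpen s) (hconv : Convex ℝ s)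
    (hg : DifferentiableOn ℂ g s) {L : ℝ} (hL : ∀ z ∈ s, sphericalDeriv g z ≤ L) {x y : ℂ}
    (hx : x ∈ s) (hy : y ∈ s) :
    dist (sphereMap (g x)) (sphereMap (g y)) ≤ 3 * L * dist x y := by
  choose T hT hTn using sphereMap_hasFDerivAt
  rw [dist_eq_norm, dist_eq_norm]
  refine hconv.norm_image_sub_le_of_norm_hasFDerivWithin_le (𝕜 := ℝ)
    (f := fun z => sphereMap (g z))
    (f' := fun z => (T (g z)).comp ((fderiv ℂ g z).restrictScalars ℝ)) (fun z hz => ?_)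
    (fun z hz => ?_) hy hx
  · exact ((hT (g z)).comp z ((hg.differentiableAt (hs.mem_nhds hz)).hasFDerivAt.restrictScalars
      ℝ)).hasFDerivWithinAt
  · refine (ContinuousLinearMap.opNorm_comp_le _ _).trans ?_
    rw [ContinuousLinearMap.norm_restrictScalars, ← norm_deriv_eq_norm_fderiv]
    calc ‖T (g z)‖ * ‖deriv g z‖ ≤ 3 * (1 + ‖g z‖ ^ 2)⁻¹ * ‖deriv g z‖ := by gcongr; exact hTn _
      _ = 3 * sphericalDeriv g z := by rw [sphericalDeriv]; ring
      _ ≤ 3 * L := by gcongr; exact hL z hz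

theorem sphereMap_fst_pos (w : ℂ) : 0 < (sphereMap w).1 := by
  simp only [sphereMap]; positivity

/-- Away from `w = 0` this makes `w⁻¹` a continuous function of the point on the sphere, including
at `∞`; at `w = 0` both sides are `0` by convention. -/
theorem inv_eq_smul_conj_sphereMap (w : ℂ) :
    w⁻¹ = (1 - (sphereMap w).1)⁻¹ • (starRingEnd ℂ) (sphereMap w).2 := by
  rcases eq_or_ne w 0 with rfl | hw
  · simp [sphereMap]
  have hw' : 0 < ‖w‖ := norm_pos_iff.2 hw
  have hpos : 0 < 1 + ‖w‖ ^ 2 := by positivity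
  have h : (1 - (1 + ‖w‖ ^ 2)⁻¹)⁻¹ * (1 + ‖w‖ ^ 2)⁻¹ = (‖w‖ ^ 2)⁻¹ := by
    rw [← mul_inv]
    congr 1
    field_simp
    ring
  simp only [sphereMap, Complex.real_smul, map_mul, Complex.conj_ofReal]
  rw [← mul_assoc, ← Complex.ofReal_mul, h, Complex.inv_def, Complex.normSq_eq_norm_sq, mul_comm]

/-- Compactness in the Riemann sphere of sequences with locally bounded spherical derivative. -/
theorem exists_subseq_sphereMap_tendsto {F : ℕ → ℂ → ℂ}
    (hF : ∀ j, DifferentiableOn ℂ (F j) (ball 0 1)) {M : ℝ}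
    (hM : ∀ j, ∀ ζ ∈ ball (0 : ℂ) 1, sphericalDeriv (F j) ζ ≤ M / (1 - ‖ζ‖)) :
    ∃ (s : ℕ → ℕ) (G : ℂ → ℝ × ℂ), StrictMono s ∧ ContinuousOn G (ball 0 1) ∧
      TendstoLocallyUniformlyOn (fun j z => sphereMap (F (s j) z)) G atTop (ball 0 1) := by
  have hM0 : 0 ≤ M := by
    simpa using (sphericalDeriv_nonneg _ _).trans (hM 0 0 (mem_ball_self one_pos))
  have hlip : ∀ a ∈ ball (0 : ℂ) 1, ∃ r > 0, ∃ L, ∀ j, ∀ x ∈ ball a r,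
      dist (sphereMap (F j x)) (sphereMap (F j a)) ≤ L * dist x a := by
    intro a ha
    rw [mem_ball_zero_iff] at ha
    -- Half the distance to the boundary, so that `1 - |z|` is at least this radius on the ball.
    have hr : 0 < (1 - ‖a‖) / 2 := by linarith
    have hnorm : ∀ z ∈ ball a ((1 - ‖a‖) / 2), ‖z‖ ≤ ‖a‖ + (1 - ‖a‖) / 2 := fun z hz => by
      rw [mem_ball, dist_eq_norm] at hz
      linarith [norm_sub_norm_le z a]
    have hsub : ball a ((1 - ‖a‖) / 2) ⊆ ball 0 1 := fun z hz => by
      rw [mem_ball_zero_iff]; linarith [hnorm z hz]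
    refine ⟨_, hr, 3 * (M / ((1 - ‖a‖) / 2)), fun j x hx =>
      dist_sphereMap_comp_le isOpen_ball (convex_ball _ _) ((hF j).mono hsub) (fun z hz => ?_) hx
        (mem_ball_self hr)⟩
    refine (hM j z (hsub hz)).trans ?_
    gcongr
    linarith [hnorm z hz]
  have hequi : Equicontinuous fun j (x : ball (0 : ℂ) 1) => sphereMap (F j x) := by
    intro a
    obtain ⟨r, hr, L, hL⟩ := hlip a a.2
    refine Metric.equicontinuousAt_of_continuity_modulus (fun x => L * dist x a) ?_ _ ?_
    · have : Continuous fun x : ball (0 : ℂ) 1 => L * dist x a := by fun_prop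
      simpa using this.tendsto a
    · filter_upwards [ball_mem_nhds a hr] with x hx j
      rw [dist_comm]
      exact hL j x hx
  have : LocallyCompactSpace (ball (0 : ℂ) 1) := isOpen_ball.locallyCompactSpace
  obtain ⟨g, s, hs, hg⟩ := exists_subseq_tendsto_of_equicontinuous
    (X := ball (0 : ℂ) 1) (isCompact_closedBall (0 : ℝ × ℂ) 1)
    (fun j => ⟨fun x => sphereMap (F j x), hequi.continuous j⟩) hequi
    (fun j x => sphereMap_mem_closedBall _)
  classical
  have hext : ((fun z : ℂ => if h : z ∈ ball (0 : ℂ) 1 then g ⟨z, h⟩ else 0) ∘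
      ((↑) : ball (0 : ℂ) 1 → ℂ)) = g := by
    ext1 x
    simp only [Function.comp_apply, dif_pos x.2]
  refine ⟨s, fun z => if h : z ∈ ball (0 : ℂ) 1 then g ⟨z, h⟩ else 0, hs, ?_, ?_⟩
  · rw [continuousOn_iff_continuous_domRestrict]
    exact (congrArg Continuous hext).mpr g.continuous
  · rw [tendstoLocallyUniformlyOn_iff_tendstoLocallyUniformly_comp_coe, hext]
    exact ContinuousMap.tendsto_iff_tendstoLocallyUniformly.1 hg

/-- The set where the limit in the Riemann sphere of holomorphic functions is `∞` is open. -/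
theorem eventually_fst_eq_zero_of_sphereMap_tendsto {F : ℕ → ℂ → ℂ} {G : ℂ → ℝ × ℂ} {U : Set ℂ}
    (hU : IsOpen U) (hF : ∀ j, DifferentiableOn ℂ (F j) U) (hG : ContinuousOn G U)
    (hlim : TendstoLocallyUniformlyOn (fun j z => sphereMap (F j z)) G atTop U) {a : ℂ}
    (ha : a ∈ U) (h0 : (G a).1 = 0) : ∀ᶠ z in 𝓝 a, (G z).1 = 0 := by
  have hcc := (tendstoLocallyUniformlyOn_iff_continuousConvergence hG).1 hlim
  have hnorm : ∀ z ∈ U, ‖(G z).2‖ ^ 2 = (G z).1 * (1 - (G z).1) := fun z hz => by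
    have h := hlim.tendsto_at hz
    have h1 : Tendsto (fun j => ‖(sphereMap (F j z)).2‖ ^ 2) atTop (𝓝 (‖(G z).2‖ ^ 2)) :=
      h.snd_nhds.norm.pow 2
    refine tendsto_nhds_unique h1 ?_
    simp only [norm_sphereMap_snd_sq]
    exact h.fst_nhds.mul (h.fst_nhds.const_sub 1)
  -- First coordinate below `1/2` means `|F| > 1`: near `a` the reciprocals are eventually
  -- holomorphic and zero-free, as Hurwitz requires.
  have hev : ∀ᶠ y : ℕ × ℂ in atTop ×ˢ 𝓝 a, (sphereMap (F y.1 y.2)).1 < 1 / 2 := by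
    have := (hcc a ha).fst_nhds
    rw [h0, hU.nhdsWithin_eq ha] at this
    exact this.eventually (gt_mem_nhds (by norm_num))
  obtain ⟨p, hp, q, hq, hpq⟩ := eventually_prod_iff.1 hev
  obtain ⟨V, hVsub, hV, haV⟩ := _root_.eventually_nhds_iff.1
    (hq.and (hU.mem_nhds ha : ∀ᶠ z in 𝓝 a, z ∈ U))
  have hVU : V ⊆ U := fun z hz => (hVsub z hz).2
  have hlt : ∀ j, p j → ∀ z ∈ V, (sphereMap (F j z)).1 < 1 / 2 := fun j hj z hz =>
    hpq hj (hVsub z hz).1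
  have hF0 : ∀ j, p j → ∀ z ∈ V, F j z ≠ 0 := fun j hj z hz h => by
    have := hlt j hj z hz
    norm_num [h, sphereMap] at this
  have hG1 : ∀ z ∈ V, (G z).1 ≤ 1 / 2 := fun z hz =>
    le_of_tendsto (hlim.tendsto_at (hVU hz)).fst_nhds (hp.mono fun j hj => (hlt j hj z hz).le)
  have hG1' : ∀ z ∈ V, 1 - (G z).1 ≠ 0 := fun z hz => by linarith [hG1 z hz]
  have hGV := hG.mono hVU
  have hinv : TendstoLocallyUniformlyOn (fun j => (F j)⁻¹)
      (fun z => (1 - (G z).1)⁻¹ • (starRingEnd ℂ) (G z).2) atTop V := by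
    refine (tendstoLocallyUniformlyOn_iff_continuousConvergence
      (((continuousOn_const.sub hGV.fst).inv₀ hG1').smul
        (Complex.continuous_conj.comp_continuousOn hGV.snd))).2 ?_
    intro z hz
    have h := (tendstoLocallyUniformlyOn_iff_continuousConvergence hGV).1 (hlim.mono hVU) z hz
    refine (((h.fst_nhds.const_sub 1).inv₀ (hG1' z hz)).smul
      ((Complex.continuous_conj.tendsto _).comp h.snd_nhds)).congr fun y => ?_
    exact (inv_eq_smul_conj_sphereMap _).symm
  have hzero := eventually_eq_zero_of_tendstoLocallyUniformlyOn hV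
    (hp.mono fun j hj => ((hF j).mono hVU).inv (hF0 j hj))
    (hp.mono fun j hj z hz => inv_ne_zero (hF0 j hj z hz)) hinv haV
    (by
      have := hnorm a ha
      rw [h0, zero_mul, sq_eq_zero_iff, norm_eq_zero] at this
      simp [this])
  filter_upwards [hzero, hV.mem_nhds haV] with z hz hzV
  have h2 : (G z).2 = 0 :=
    (map_eq_zero _).1 ((smul_eq_zero.1 hz).resolve_left (inv_ne_zero (hG1' z hzV)))
  have h3 := hnorm z (hVU hzV)
  rw [h2, norm_zero, zero_pow two_ne_zero] at h3
  exact (mul_eq_zero.1 h3.symm).resolve_right (hG1' z hzV)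

/-! ### Marty's theorem, sufficiency, and the conclusion. -/

/-- **Marty's theorem**, sufficiency. -/
theorem exists_subseq_of_sphericalDeriv_le {F : ℕ → ℂ → ℂ}
    (hF : ∀ j, DifferentiableOn ℂ (F j) (ball 0 1)) {M : ℝ}
    (hM : ∀ j, ∀ ζ ∈ ball (0 : ℂ) 1, sphericalDeriv (F j) ζ ≤ M / (1 - ‖ζ‖)) :
    (∃ (s : ℕ → ℕ) (g : ℂ → ℂ), StrictMono s ∧
      ∀ K ⊆ ball (0 : ℂ) 1, IsCompact K → TendstoUniformlyOn (fun j => F (s j)) g atTop K) ∨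
    (∃ s : ℕ → ℕ, StrictMono s ∧
      ∀ K ⊆ ball (0 : ℂ) 1, IsCompact K → ∀ R : ℝ, ∀ᶠ j in atTop, ∀ x ∈ K, R < ‖F (s j) x‖) := by
  obtain ⟨s, G, hs, hG, hlim⟩ := exists_subseq_sphereMap_tendsto hF hM
  have hclopen : IsClopen {x : ball (0 : ℂ) 1 | (G x).1 = 0} := by
    constructor
    · exact isClosed_eq (continuousOn_iff_continuous_domRestrict.1 hG).fst continuous_const
    · rw [isOpen_iff_mem_nhds]
      exact fun x hx => continuous_subtype_val.tendsto x <|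
        eventually_fst_eq_zero_of_sphereMap_tendsto isOpen_ball (fun j => hF (s j)) hG hlim x.2 hx
  have : PreconnectedSpace (ball (0 : ℂ) 1) :=
    Subtype.preconnectedSpace (convex_ball _ _).isPreconnected
  rcases isClopen_iff.1 hclopen with hempty | huniv
  · left
    have hne : ∀ z ∈ ball (0 : ℂ) 1, (G z).1 ≠ 0 := fun z hz h =>
      (Set.ext_iff.1 hempty ⟨z, hz⟩).1 h
    -- Off `∞`, a point of the plane is the quotient of its two sphere coordinates.
    refine ⟨s, fun z => (G z).1⁻¹ • (G z).2, hs, ?_⟩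
    rw [← tendstoLocallyUniformlyOn_iff_forall_isCompact isOpen_ball]
    refine (tendstoLocallyUniformlyOn_iff_continuousConvergence
      ((hG.fst.inv₀ hne).smul hG.snd)).2 ?_
    intro z hz
    have h := (tendstoLocallyUniformlyOn_iff_continuousConvergence hG).1 hlim z hz
    refine ((h.fst_nhds.inv₀ (hne z hz)).smul h.snd_nhds).congr fun y => ?_
    exact inv_smul_smul₀ (sphereMap_fst_pos _).ne' _
  · right
    refine ⟨s, hs, fun K hK hKc R => ?_⟩
    -- A first coordinate below this threshold says `|w|² > R²`.
    have hpos : 0 < (1 + R ^ 2)⁻¹ := by positivity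
    have hunif := (tendstoLocallyUniformlyOn_iff_forall_isCompact isOpen_ball).1 hlim K hK hKc
    rw [Metric.tendstoUniformlyOn_iff] at hunif
    filter_upwards [hunif _ hpos] with j hj x hx
    have h0 : (G x).1 = 0 := (Set.ext_iff.1 huniv ⟨x, hK hx⟩).2 trivial
    have h1 : dist (G x).1 (sphereMap (F (s j) x)).1 < (1 + R ^ 2)⁻¹ :=
      (le_max_left _ _).trans_lt (hj x hx)
    rw [h0, dist_zero_left, Real.norm_of_nonneg (sphereMap_fst_pos _).le] at h1
    simp only [sphereMap] at h1
    rw [inv_lt_inv₀ (by positivity) (by positivity), add_lt_add_iff_left] at h1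
    exact lt_of_pow_lt_pow_left₀ 2 (norm_nonneg _) h1

end NormalFunctions

theorem mainTheorem1 (n : ℕ) (Ω : Set (EuclideanSpace ℂ (Fin n)))
    (hΩ_open : IsOpen Ω) (hΩ_conn : IsConnected Ω)
    (f : EuclideanSpace ℂ (Fin n) → ℂ) (hf : DifferentiableOn ℂ f Ω) :
    NormalFunctions.IsNormalFunction Ω f ↔
      NormalFunctions.IsNormalFamilyOn
        {g : ℂ → ℂ | ∃ φ ∈ NormalFunctions.holDiscs Ω, g = f ∘ φ} (Metric.ball (0 : ℂ) 1) := by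
  rw [NormalFunctions.isNormalFunction_iff_sphericalDeriv_le hΩ_open hf]
  constructor
  · rintro ⟨M, hM⟩ u hu
    choose φ hφ hφu using hu
    refine NormalFunctions.exists_subseq_of_sphericalDeriv_le (M := M) (fun j => ?_)
      fun j ζ hζ => ?_
    · rw [hφu j]; exact NormalFunctions.differentiableOn_comp_of_mem_holDiscs hf (hφ j)
    · rw [hφu j]; exact NormalFunctions.sphericalDeriv_comp_le hf hM (hφ j) hζ
  · intro h
    obtain ⟨M, hM⟩ := h.exists_sphericalDeriv_le <| by
      rintro _ ⟨φ, hφ, rfl⟩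
      exact NormalFunctions.differentiableOn_comp_of_mem_holDiscs hf hφ
    exact ⟨M, fun φ hφ => hM _ ⟨φ, hφ, rfl⟩⟩
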